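/- All rings are associative with identity, not necessarily commutative, and ring homomorphisms preserve the identity. A group $G$ is called *fully realizable* if there is a ring $R$ and an isomorphism of groups $R^\times \cong G$ such that, identifying $R^\times$ with $G$ along it, every group endomorphism of $G$ is the restriction to units of some ring endomorphism of $R$. A group is *simple* if it is nontrivial and its only normal subgroups are the trivial subgroup and the whole group. Let $\mathbf{A}_n$ denote the alternating group on $n$ letters. **Theorem.** The groups $\mathbf{A}_2$ and $\mathbf{A}_3$ are fully realizable, and for every integer $n \ge 4$ the following are equivalent: 1. $n = 4$; 2. $\mathbf{A}_n$ is fully realizable; 3. $\mathbf{A}_n$ is not simple. -/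

import Mathlib

universe u v

/-- The ring `R` (with identity, not necessarily commutative) fully realizes the group `G`:
there is an isomorphism `e` from the unit group of `R` to `G` under which every group endomorphism
of `G` is the map `Units.map φ` induced on units by some (unital) ring endomorphism `φ` of `R`. -/
def FullyRealizes (R : Type v) [Ring R] (G : Type u) [Group G] : Prop :=
  ∃ e : Rˣ ≃* G, ∀ f : G →* G, ∃ φ : R →+* R,
    ∀ x : Rˣ, e (Units.map (φ : R →* R) x) = f (e x)

/-- The group `G` is fully realizable: some ring (in the universe `v`) fully realizes it. -/
def FullyRealizable (G : Type u) [Group G] : Prop :=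
  ∃ (R : Type v) (_ : Ring R), FullyRealizes R G

/-! Extending the trivial endomorphism sends -1 both to 1 and to -1, so a ring that fully realizes a
group has characteristic 2. If the group is finite simple with trivial centre, the subring generated
by the units is a quotient of a subring of a finite ring, hence finite, and its Jacobson radical J
vanishes because 1 + J is a normal 2-subgroup. By Wedderburn the subring is a product of matrix
rings. One block, over the field F₂, carries all units; the other blocks are commutative. An
endomorphism extending a group automorphism descends to that block, where it is inner
(`exists_units_map_eq_conj`). Hence an outer automorphism, such as conjugation by a transposition on
A_n for n ≥ 5, rules out full realizability.

The small cases are explicit: F₂ for A₂, F₄ × F₂ for A₃, and for A₄ the triangular matrices with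
upper row in F₄ and lower right entry in F₂, whose units form the affine group of the line over F₄.
-/

/-- Every algebra automorphism of a matrix algebra over a field is inner. -/
theorem Matrix.exists_units_conj_of_algEquiv {K n : Type*} [Field K] [Fintype n] [DecidableEq n]
    (ψ : Matrix n n K ≃ₐ[K] Matrix n n K) :
    ∃ x : (Matrix n n K)ˣ, ∀ A, ψ A = x * A * (x⁻¹ : (Matrix n n K)ˣ) := by
  let θ : Matrix n n K ≃ₐ[K] Module.End K (n → K) := Matrix.toLinAlgEquiv'
  obtain ⟨T, hT⟩ := ((θ.symm.trans ψ).trans θ).eq_linearEquivConjAlgEquiv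
  refine ⟨Units.map (θ.symm : Module.End K (n → K) →* Matrix n n K)
    (LinearMap.GeneralLinearGroup.ofLinearEquiv T), fun A ↦ θ.injective ?_⟩
  have h := congr($hT (θ A))
  simp only [AlgEquiv.trans_apply, AlgEquiv.symm_apply_apply] at h
  rw [h, ← map_inv]
  simp only [map_mul, Units.coe_map, MonoidHom.coe_coe, AlgEquiv.apply_symm_apply]
  rfl

/-- A matrix which annihilates all commutators of a noncommutative matrix algebra vanishes. -/
theorem Matrix.eq_zero_of_mul_commutator_eq_zero {K n : Type*} [Ring K] [Fintype n]
    [DecidableEq n] [Nontrivial n] {T : Matrix n n K}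
    (hT : ∀ A B : Matrix n n K, T * (A * B - B * A) = 0) : T = 0 := by
  ext k i
  obtain ⟨j, hj⟩ := exists_ne i
  -- For j ≠ i the commutator of E_ii and E_ij is E_ij, and T E_ij has (k, j) entry T k i.
  have h := congr_fun (congr_fun (hT (single i i 1) (single i j 1)) k) j
  simpa [hj, Matrix.single_mul_single_of_ne] using h

/-! ### Finite rings of characteristic two with simple unit group -/

section FiniteRing

variable {S : Type v} [Ring S] [Finite S]

/-- If the unit group of a finite ring of characteristic two is simple with trivial centre,
then the ring is semisimple. -/
theorem isSemisimpleRing_of_isSimpleGroup_units (h2 : (2 : S) = 0) [IsSimpleGroup Sˣ]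
    (hc : Subgroup.center Sˣ = ⊥) : IsSemisimpleRing S := by
  rw [IsArtinianRing.isSemisimpleRing_iff_jacobson, eq_bot_iff]
  have hnil : ∀ x ∈ Ring.jacobson S, IsNilpotent x := by
    intro x hx
    obtain ⟨n, hn⟩ := IsSemiprimaryRing.isNilpotent (R := S)
    exact ⟨n, by simpa [hn] using Ideal.pow_mem_pow hx n⟩
  let q : Sˣ →* (S ⧸ Ring.jacobson S)ˣ :=
    Units.map (Ideal.Quotient.mk (Ring.jacobson S) : S →* S ⧸ Ring.jacobson S)
  have hq (u : Sˣ) : u ∈ q.ker ↔ (u : S) - 1 ∈ Ring.jacobson S := by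
    rw [MonoidHom.mem_ker, Units.ext_iff, ← Ideal.Quotient.mk_eq_mk_iff_sub_mem]
    simp [q]
  rcases q.normal_ker.eq_bot_or_eq_top with h | h
  · intro x hx
    obtain ⟨u, hu⟩ := (hnil x hx).isUnit_one_add
    have hmem : u ∈ q.ker := by rw [hq, hu]; simpa using hx
    rw [h, Subgroup.mem_bot] at hmem
    simpa [hmem] using hu
  · exfalso
    have : CharP S 2 := CharTwo.of_one_ne_zero_of_two_eq_zero (by
      intro h10
      have := subsingleton_of_zero_eq_one h10.symm
      exact not_subsingleton Sˣ inferInstance) h2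
    -- Here u - 1 is nilpotent for every unit u, and u^(2^n) - 1 = (u - 1)^(2^n).
    have hp : IsPGroup 2 Sˣ := by
      intro u
      have hu : u ∈ q.ker := h ▸ Subgroup.mem_top u
      obtain ⟨n, hn⟩ := hnil _ ((hq u).1 hu)
      refine ⟨n, Units.ext ?_⟩
      have h1 := pow_eq_zero_of_le (Nat.lt_two_pow_self (n := n)).le hn
      have h3 := sub_pow_char_pow_of_commute 2 n (Commute.one_right (u : S))
      rw [h1, one_pow] at h3
      simpa using (sub_eq_zero.1 h3.symm)
    have := hp.center_nontrivial
    rw [hc] at this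
    exact not_subsingleton _ (inferInstance : Subsingleton (⊥ : Subgroup Sˣ))

/-- A quotient `A` of a ring generated by its units is commutative if `A` has no nontrivial
units. -/
theorem commute_of_closure_units_eq_top {A : Type*} [Ring A] {R : Type*} [Ring R]
    (hgen : Subring.closure {x : R | IsUnit x} = ⊤) (f : R →+* A)
    (hf : Function.Surjective f) (hA : Subsingleton Aˣ) (a b : A) : a * b = b * a := by
  obtain ⟨r, rfl⟩ := hf a
  have hr : r ∈ Subring.closure {x : R | IsUnit x} := hgen ▸ Subring.mem_top r
  have hle : Subring.closure {x : R | IsUnit x} ≤ (Subring.center A).comap f := by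
    rw [Subring.closure_le]
    rintro x ⟨u, rfl⟩
    have : f u = 1 := congr_arg Units.val
      (Subsingleton.elim (Units.map (f : R →* A) u) 1)
    simp [this]
  exact ((Subring.mem_center_iff.1 (hle hr)) b).symm

/-- A finite ring of characteristic two generated by its units, whose unit group is simple with
trivial centre, has a matrix ring over the field with two elements as a quotient with the same units
and with kernel annihilating all commutators. -/
theorem exists_matrix_quotient (h2 : (2 : S) = 0) [IsSimpleGroup Sˣ]
    (hc : Subgroup.center Sˣ = ⊥) (hgen : Subring.closure {x : S | IsUnit x} = ⊤) :
    ∃ (m : ℕ) (K : Type v) (_ : Field K) (π : S →+* Matrix (Fin m) (Fin m) K),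
      (∀ x : K, x = 0 ∨ x = 1) ∧ Nontrivial (Fin m) ∧ Function.Surjective π ∧
      Function.Bijective (Units.map (π : S →* Matrix (Fin m) (Fin m) K)) ∧
      ∀ x, π x = 0 → ∀ a b : S, x * (a * b - b * a) = 0 := by
  have := isSemisimpleRing_of_isSimpleGroup_units h2 hc
  obtain ⟨n, D, d, _, hd, ⟨e⟩⟩ := IsSemisimpleRing.exists_ringEquiv_pi_matrix_divisionRing S
  let p (i : Fin n) : S →+* Matrix (Fin (d i)) (Fin (d i)) (D i) :=
    (Pi.evalRingHom (fun i ↦ Matrix (Fin (d i)) (Fin (d i)) (D i)) i).comp e.toRingHom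
  have hp (i) (x : S) : p i x = e x i := rfl
  have hps (i) : Function.Surjective (p i) := fun y ↦
    ⟨e.symm (Pi.single i y), by simp [hp]⟩
  let P (i : Fin n) : Sˣ →* (Matrix (Fin (d i)) (Fin (d i)) (D i))ˣ :=
    Units.map (p i : S →* Matrix (Fin (d i)) (Fin (d i)) (D i))
  let E : Sˣ ≃* ∀ i, (Matrix (Fin (d i)) (Fin (d i)) (D i))ˣ :=
    (Units.mapEquiv e.toMulEquiv).trans MulEquiv.piUnits
  have hE (i) (u : Sˣ) : E u i = P i u := rfl
  have hPs (i) : Function.Surjective (P i) := fun y ↦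
    ⟨E.symm (Pi.mulSingle i y), by rw [← hE]; simp⟩
  obtain ⟨i, hi⟩ : ∃ i, Nontrivial (Matrix (Fin (d i)) (Fin (d i)) (D i))ˣ := by
    by_contra! h
    exact not_subsingleton Sˣ E.toEquiv.subsingleton
  have hker : (P i).ker = ⊥ := by
    refine (P i).normal_ker.eq_bot_or_eq_top.resolve_right fun h ↦ ?_
    obtain ⟨y, hy⟩ := exists_ne (1 : (Matrix (Fin (d i)) (Fin (d i)) (D i))ˣ)
    obtain ⟨u, rfl⟩ := hPs i y
    exact hy ((P i).mem_ker.1 (h ▸ Subgroup.mem_top u))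
  have hPinj : Function.Injective (P i) := (P i).ker_eq_bot_iff.1 hker
  -- A unit supported in block j is trivial in block i, hence trivial.
  have hsub (j) (hj : j ≠ i) : Subsingleton (Matrix (Fin (d j)) (Fin (d j)) (D j))ˣ := by
    refine ⟨fun y z ↦ Pi.mulSingle_injective j (E.symm.injective (hPinj ?_))⟩
    rw [← hE, ← hE]
    simp [Pi.mulSingle_eq_of_ne hj.symm]
  have : Finite (D i) := by
    have := Finite.of_surjective _ (hps i)
    exact Finite.of_injective (Matrix.scalar (Fin (d i))) fun a b h ↦ by simpa using h
  let F : Field (D i) := littleWedderburn (D i)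
  have hcen : Subgroup.center (Matrix (Fin (d i)) (Fin (d i)) (D i))ˣ = ⊥ := by
    rw [eq_bot_iff]
    intro z hz
    obtain ⟨u, rfl⟩ := hPs i z
    have hu : u ∈ Subgroup.center Sˣ := by
      rw [Subgroup.mem_center_iff] at hz ⊢
      intro g
      apply hPinj
      simpa using hz (P i g)
    rw [hc, Subgroup.mem_bot] at hu
    simp [hu]
  -- Nonzero scalars are central units, so only 1 is possible.
  have hD (x : D i) : x = 0 ∨ x = 1 := by
    refine or_iff_not_imp_left.2 fun hx ↦ ?_
    let w : (Matrix (Fin (d i)) (Fin (d i)) (D i))ˣ :=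
      Units.map ((Matrix.scalar (Fin (d i)) : D i →+* Matrix (Fin (d i)) (Fin (d i)) (D i)) :
        D i →* Matrix (Fin (d i)) (Fin (d i)) (D i)) (Units.mk0 x hx)
    have hw : w ∈ Subgroup.center (Matrix (Fin (d i)) (Fin (d i)) (D i))ˣ := by
      rw [Subgroup.mem_center_iff]
      intro g
      apply Units.ext
      exact (Matrix.scalar_commute x (fun r ↦ mul_comm x r)
        (g : Matrix (Fin (d i)) (Fin (d i)) (D i))).symm
    rw [hcen, Subgroup.mem_bot] at hw
    have hw' : Matrix.scalar (Fin (d i)) x = 1 := congr_arg Units.val hw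
    have := hd i
    simpa using congr_fun (congr_fun hw' 0) 0
  refine ⟨d i, D i, F, p i, hD, ?_, hps i, ⟨hPinj, hPs i⟩, fun x hx a b ↦ ?_⟩
  · rw [← not_subsingleton_iff_nontrivial]
    intro hs
    obtain ⟨y, hy⟩ := exists_ne (1 : (Matrix (Fin (d i)) (Fin (d i)) (D i))ˣ)
    have hmem : y ∈ Subgroup.center (Matrix (Fin (d i)) (Fin (d i)) (D i))ˣ := by
      rw [Subgroup.mem_center_iff]
      intro g
      ext a b
      obtain rfl := Subsingleton.elim a b
      simp [Matrix.mul_apply, Fintype.sum_subsingleton _ a, mul_comm]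
    rw [hcen, Subgroup.mem_bot] at hmem
    exact hy hmem
  · apply e.injective
    ext1 j
    by_cases hj : j = i
    · subst hj
      rw [map_mul, Pi.mul_apply, ← hp, hx, zero_mul, map_zero, Pi.zero_apply]
    · have := commute_of_closure_units_eq_top hgen (p j) (hps j) (hsub j hj) (p j a) (p j b)
      rw [← hp, ← hp]
      rw [map_mul, map_sub, map_mul, map_mul, this, sub_self, mul_zero, map_zero]

/-- In a finite ring of characteristic two generated by its units, whose unit group is simple with
trivial centre, every ring endomorphism that is surjective on units acts on them by an inner
automorphism. -/
theorem exists_units_map_eq_conj (h2 : (2 : S) = 0) [IsSimpleGroup Sˣ]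
    (hc : Subgroup.center Sˣ = ⊥) (hgen : Subring.closure {x : S | IsUnit x} = ⊤)
    (φ : S →+* S) (hφ : Function.Surjective (Units.map (φ : S →* S))) :
    ∃ y : Sˣ, ∀ u : Sˣ, Units.map (φ : S →* S) u = y * u * y⁻¹ := by
  obtain ⟨m, K, _, π, hK, _, hπ, ⟨hinj, hsurj⟩, hcomm⟩ := exists_matrix_quotient h2 hc hgen
  have hφs : Function.Surjective φ := by
    rw [← RingHom.range_eq_top, eq_top_iff, ← hgen, Subring.closure_le]
    rintro x ⟨u, rfl⟩
    obtain ⟨w, rfl⟩ := hφ u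
    exact ⟨w, rfl⟩
  have hρ : Function.Surjective (π.comp φ) := hπ.comp hφs
  -- Elements of the kernel annihilate commutators, and the commutators of the matrix ring all lift
  -- along the surjection `π.comp φ`.
  have hle : RingHom.ker π ≤ RingHom.ker (π.comp φ) := by
    intro x hx
    refine Matrix.eq_zero_of_mul_commutator_eq_zero fun A B ↦ ?_
    obtain ⟨a, rfl⟩ := hρ A
    obtain ⟨b, rfl⟩ := hρ B
    rw [← map_mul, ← map_mul, ← map_sub, ← map_mul, hcomm x hx, map_zero]
  let ψ := π.liftOfSurjective hπ ⟨π.comp φ, hle⟩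
  have hψ (x : S) : ψ (π x) = π (φ x) := π.liftOfRightInverse_comp_apply _ _ ⟨π.comp φ, hle⟩ x
  have : Finite (Matrix (Fin m) (Fin m) K) := Finite.of_surjective _ hπ
  have hψs : Function.Surjective ψ := fun A ↦ by
    obtain ⟨a, rfl⟩ := hρ A
    exact ⟨π a, hψ a⟩
  let Ψ : Matrix (Fin m) (Fin m) K ≃ₐ[K] Matrix (Fin m) (Fin m) K :=
    AlgEquiv.ofRingEquiv (f := RingEquiv.ofBijective ψ
      ⟨Finite.injective_iff_surjective.2 hψs, hψs⟩) fun r ↦ by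
        rcases hK r with rfl | rfl <;> simp
  obtain ⟨x, hx⟩ := Matrix.exists_units_conj_of_algEquiv Ψ
  obtain ⟨y, rfl⟩ := hsurj x
  refine ⟨y, fun u ↦ hinj (Units.ext ?_)⟩
  have h : ψ (π u) = _ := hx (π u)
  rw [← map_inv, hψ] at h
  simpa using h

end FiniteRing

/-! ### Outer automorphisms as an obstruction -/

/-- A finite simple group with trivial centre and an outer automorphism is not fully realizable. -/
theorem not_fullyRealizable_of_outer {G : Type u} [Group G] [Finite G] [IsSimpleGroup G]
    (hc : Subgroup.center G = ⊥) (σ : G ≃* G) (hσ : ∀ y : G, ∃ g : G, σ g ≠ y * g * y⁻¹) :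
    ¬ FullyRealizable.{u, v} G := by
  rintro ⟨R, _, e, he⟩
  have h2 : (2 : R) = 0 := by
    obtain ⟨φ, hφ⟩ := he 1
    have h := congr_arg Units.val (e.injective ((hφ (-1)).trans (map_one e).symm))
    have h' : (-1 : R) = 1 := by simpa using h
    rw [← one_add_one_eq_two]
    nth_rewrite 1 [← h']
    exact neg_add_cancel 1
  let S : Subring R := Subring.closure {x : R | IsUnit x}
  have : Finite Rˣ := Finite.of_equiv G e.symm
  have : Finite S := by
    have : Nontrivial Rˣ := e.toEquiv.nontrivial
    have : CharP R 2 := CharTwo.of_one_ne_zero_of_two_eq_zero (fun h10 ↦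
      have := subsingleton_of_zero_eq_one h10.symm
      not_subsingleton Rˣ inferInstance) h2
    let _ : Algebra (ZMod 2) R := ZMod.algebra R 2
    let F : MonoidAlgebra (ZMod 2) Rˣ →ₐ[ZMod 2] R := MonoidAlgebra.lift _ _ _ (Units.coeHom R)
    have : Finite (MonoidAlgebra (ZMod 2) Rˣ) := Module.finite_of_finite (ZMod 2)
    have hF : S ≤ F.toRingHom.range := by
      rw [Subring.closure_le]
      rintro x ⟨u, rfl⟩
      exact ⟨MonoidAlgebra.of _ _ u, by simp [F]⟩
    have : Finite F.toRingHom.range := Finite.of_surjective _ F.toRingHom.rangeRestrict_surjective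
    exact Finite.of_injective _ (Subring.inclusion_injective hF)
  let j : Rˣ ≃* Sˣ :=
    { toFun := fun u ↦ ⟨⟨u, Subring.subset_closure u.isUnit⟩,
        ⟨(u⁻¹ : Rˣ), Subring.subset_closure (u⁻¹).isUnit⟩, by ext; simp, by ext; simp⟩
      invFun := Units.map (S.subtype : S →* R)
      left_inv := fun u ↦ by ext; rfl
      right_inv := fun u ↦ by ext; rfl
      map_mul' := fun u w ↦ by ext; rfl }
  have hj (u : Rˣ) : ((j u : S) : R) = u := rfl
  have hgen : Subring.closure {x : S | IsUnit x} = ⊤ := by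
    have himg : Subring.closure {x : R | IsUnit x} ≤
        (Subring.closure {x : S | IsUnit x}).map S.subtype := by
      rw [Subring.closure_le]
      rintro x ⟨u, rfl⟩
      exact ⟨j u, Subring.subset_closure (j u).isUnit, rfl⟩
    rw [eq_top_iff]
    rintro ⟨x, hx⟩ -
    obtain ⟨y, hy, hyx⟩ := himg hx
    obtain rfl : y = ⟨x, hx⟩ := Subtype.ext hyx
    exact hy
  let E : Sˣ ≃* G := j.symm.trans e
  have : Nontrivial Sˣ := E.toEquiv.nontrivial
  have : IsSimpleGroup Sˣ :=
    IsSimpleGroup.isSimpleGroup_of_surjective E.symm.toMonoidHom E.symm.surjective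
  have hcS : Subgroup.center Sˣ = ⊥ := by
    rw [eq_bot_iff]
    intro z hz
    have : E z ∈ Subgroup.center G := by
      rw [Subgroup.mem_center_iff] at hz ⊢
      intro g
      obtain ⟨u, rfl⟩ := E.surjective g
      rw [← map_mul, ← map_mul, hz]
    simpa [hc] using this
  obtain ⟨φ, hφ⟩ := he σ.toMonoidHom
  have hφS : ∀ x ∈ S, φ x ∈ S := by
    have : S ≤ S.comap φ := by
      rw [Subring.closure_le]
      rintro x hx
      exact Subring.subset_closure (hx.map φ)
    exact this
  let φS : S →+* S := φ.restrict S S hφS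
  have hEφ (u : Sˣ) : E (Units.map (φS : S →* S) u) = σ (E u) := by
    obtain ⟨u, rfl⟩ := j.surjective u
    refine Eq.trans ?_ ((hφ u).trans ?_)
    · exact congr_arg e (Units.ext rfl)
    · simp [E]
  have h2S : (2 : S) = 0 := Subtype.ext h2
  obtain ⟨y, hy⟩ := exists_units_map_eq_conj h2S hcS hgen φS fun u ↦
    ⟨E.symm (σ.symm (E u)), E.injective (by rw [hEφ]; simp)⟩
  obtain ⟨g, hg⟩ := hσ (E y)
  apply hg
  have := hEφ (E.symm g)
  rw [hy] at this
  simpa using this.symm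

/-! ### Alternating groups: the outer automorphism, and simplicity -/

/-- A permutation commuting with all even permutations of at least four letters is trivial. -/
theorem Equiv.Perm.eq_one_of_forall_commute_alternatingGroup {α : Type*} [Fintype α]
    [DecidableEq α] (hα : 4 ≤ Fintype.card α) {g : Equiv.Perm α}
    (hg : ∀ k ∈ alternatingGroup α, k * g = g * k) : g = 1 := by
  ext a
  by_contra hab
  rw [Equiv.Perm.coe_one, id] at hab
  have : 1 < (({a, g a} : Finset α)ᶜ).card := by
    have := Finset.card_add_card_compl ({a, g a} : Finset α)
    have := Finset.card_le_two (a := a) (b := g a)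
    omega
  obtain ⟨c, d, hc, hd, hcd⟩ := Finset.one_lt_card_iff.1 this
  simp only [Finset.mem_compl, Finset.mem_insert, Finset.mem_singleton, not_or] at hc hd
  -- This 3-cycle fixes a and sends g a to c, so commuting with g would give c = g a.
  have h := congr($(hg (Equiv.swap (g a) d * Equiv.swap (g a) c)
    (by simp [Equiv.Perm.mem_alternatingGroup, Ne.symm hc.2, Ne.symm hd.2])) a)
  simp only [Equiv.Perm.mul_apply, Equiv.swap_apply_left] at h
  rw [Equiv.swap_apply_of_ne_of_ne hc.2 hcd,
    Equiv.swap_apply_of_ne_of_ne (Ne.symm hab) (Ne.symm hc.1),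
    Equiv.swap_apply_of_ne_of_ne (Ne.symm hab) (Ne.symm hd.1)] at h
  exact hc.2 h

/-- If conjugation by a transposition s agreed with conjugation by an even y, then y⁻¹s would
centralize A_n, forcing s = y. -/
theorem not_fullyRealizable_alternatingGroup {n : ℕ} (hn : 5 ≤ n) :
    ¬ FullyRealizable.{0, v} (alternatingGroup (Fin n)) := by
  have : IsSimpleGroup (alternatingGroup (Fin n)) := alternatingGroup.isSimpleGroup (by simpa)
  let s : Equiv.Perm (Fin n) := Equiv.swap ⟨0, by omega⟩ ⟨1, by omega⟩
  have hs : s ∉ alternatingGroup (Fin n) := by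
    rw [Equiv.Perm.mem_alternatingGroup, Equiv.Perm.sign_swap (by simp)]
    decide
  refine not_fullyRealizable_of_outer (alternatingGroup.center_eq_bot (by simp; omega))
    (MulAut.conjNormal s) fun y ↦ ?_
  by_contra! h
  refine hs ?_
  have hys : (y : Equiv.Perm (Fin n))⁻¹ * s = 1 := by
    refine Equiv.Perm.eq_one_of_forall_commute_alternatingGroup (by simp; omega) fun k hk ↦ ?_
    have := congr_arg Subtype.val (h ⟨k, hk⟩)
    rw [MulAut.conjNormal_apply] at this
    simp only [Subgroup.coe_mul, Subgroup.coe_inv] at this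
    rw [mul_inv_eq_iff_eq_mul] at this
    rw [mul_assoc, this]
    group
  rw [inv_mul_eq_one] at hys
  rw [← hys]
  exact y.2

theorem not_isSimpleGroup_alternatingGroup_four : ¬ IsSimpleGroup (alternatingGroup (Fin 4)) := by
  intro h
  have h4 : Nat.card (Fin 4) = 4 := by simp
  have hk := alternatingGroup.kleinFour_card_of_card_eq_four h4
  have hA := alternatingGroup.card_of_card_eq_four h4
  rcases (alternatingGroup.normal_kleinFour h4).eq_bot_or_eq_top with h' | h'
  · rw [h'] at hk
    simp at hk
  · rw [h', Subgroup.card_top] at hk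
    omega

/-! ### Realizing rings for degrees two and three -/

/-- Full realizability is invariant under isomorphism of groups and under lifting the universe of
the realizing ring. -/
theorem FullyRealizes.fullyRealizable {R : Type u} [Ring R] {G : Type*} [Group G]
    (h : FullyRealizes R G) {H : Type*} [Group H] (g : G ≃* H) :
    FullyRealizable.{_, max u v} H := by
  obtain ⟨e, he⟩ := h
  let r : ULift.{v} R ≃+* R := ULift.ringEquiv
  refine ⟨ULift.{v} R, inferInstance, ((Units.mapEquiv r.toMulEquiv).trans e).trans g, fun f ↦ ?_⟩
  obtain ⟨φ, hφ⟩ := he ((g.symm.toMonoidHom.comp f).comp g.toMonoidHom)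
  refine ⟨(r.symm.toRingHom.comp φ).comp r.toRingHom, fun x ↦ ?_⟩
  have := congr_arg g (hφ (Units.mapEquiv r.toMulEquiv x))
  simp only [MonoidHom.comp_apply, MulEquiv.coe_toMonoidHom, MulEquiv.apply_symm_apply] at this
  refine Eq.trans ?_ this
  exact congr_arg (g ∘ e) (Units.ext rfl)

/-- A ring fully realizes its own unit group once every endomorphism of the unit group extends. -/
theorem fullyRealizes_units {R : Type u} [Ring R]
    (h : ∀ f : Rˣ →* Rˣ, ∃ φ : R →+* R, Units.map (φ : R →* R) = f) : FullyRealizes R Rˣ :=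
  ⟨MulEquiv.refl _, fun f ↦ (h f).imp fun _ hφ x ↦ DFunLike.congr_fun hφ x⟩

theorem fullyRealizable_alternatingGroup_two :
    FullyRealizable.{0, v} (alternatingGroup (Fin 2)) := by
  have : Subsingleton (alternatingGroup (Fin 2)) := by
    rw [alternatingGroup.eq_bot_of_card_le_two (by simp)]
    infer_instance
  let _ : Unique (alternatingGroup (Fin 2)) :=
    { default := 1, uniq := fun _ ↦ Subsingleton.elim _ _ }
  exact (fullyRealizes_units (R := ZMod 2) fun f ↦
    ⟨RingHom.id _, MonoidHom.ext fun x ↦ Subsingleton.elim _ _⟩).fullyRealizable MulEquiv.ofUnique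

/-- The field with four elements, as the quadratic algebra generated by `ω` with `ω² = 1 + ω`. -/
abbrev FieldFour : Type := QuadraticAlgebra (ZMod 2) 1 1

namespace FieldFour

instance : Fintype FieldFour := Fintype.ofEquiv _ (QuadraticAlgebra.equivProd 1 1).symm

instance : CharP FieldFour 2 := CharTwo.of_one_ne_zero_of_two_eq_zero (by decide) (by decide)

/-- The generator `ω` of the field with four elements. -/
abbrev gen : FieldFour := ⟨0, 1⟩

/-- The Frobenius automorphism over the prime field. -/
def frob : FieldFour →ₐ[ZMod 2] FieldFour :=
  { frobenius FieldFour 2 with commutes' := by decide }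

/-- The ring homomorphism `(a, c) ↦ (c, c)`. -/
def collapse : FieldFour × ZMod 2 →+* FieldFour × ZMod 2 :=
  ((algebraMap (ZMod 2) FieldFour).prod (RingHom.id _)).comp (RingHom.snd _ _)

/-- The generator of the unit group of `FieldFour × ZMod 2`. -/
def unitGen : (FieldFour × ZMod 2)ˣ :=
  ⟨(gen, 1), (gen ^ 2, 1), by decide, by decide⟩

theorem exists_eq_unitGen_pow (u : (FieldFour × ZMod 2)ˣ) : ∃ i : Fin 3, u = unitGen ^ (i : ℕ) := by
  have key : ∀ x y : FieldFour × ZMod 2, x * y = 1 → ∃ i : Fin 3, x = (gen, 1) ^ (i : ℕ) := by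
    decide
  obtain ⟨i, hi⟩ := key u (u⁻¹ : (FieldFour × ZMod 2)ˣ) u.mul_inv
  exact ⟨i, Units.ext (by simpa [unitGen] using hi)⟩

theorem orderOf_unitGen : orderOf unitGen = 3 := by
  refine orderOf_eq_prime (Units.ext ?_) fun h ↦ ?_
  · change ((gen, 1) : FieldFour × ZMod 2) ^ 3 = 1
    decide
  · revert h
    decide

theorem card_units : Nat.card (FieldFour × ZMod 2)ˣ = 3 := by
  rw [← orderOf_unitGen]
  refine (orderOf_eq_card_of_forall_mem_zpowers fun u ↦ ?_).symm
  obtain ⟨i, rfl⟩ := exists_eq_unitGen_pow u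
  exact Subgroup.npow_mem_zpowers _ _

/-- F₄ alone would not do: its ring endomorphisms are injective. The factor F₂ supplies `collapse`,
which extends the trivial endomorphism; Frobenius extends squaring. -/
theorem fullyRealizes : FullyRealizes (FieldFour × ZMod 2) (FieldFour × ZMod 2)ˣ := by
  refine fullyRealizes_units fun f ↦ ?_
  have ext (φ : FieldFour × ZMod 2 →+* FieldFour × ZMod 2)
      (h : φ (gen, 1) = f unitGen) : Units.map (φ : _ →* FieldFour × ZMod 2) = f := by
    ext1 u
    obtain ⟨i, rfl⟩ := exists_eq_unitGen_pow u
    rw [map_pow, map_pow]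
    congr 1
    exact Units.ext h
  obtain ⟨i, hi⟩ := exists_eq_unitGen_pow (f unitGen)
  have hi' : ((f unitGen : (FieldFour × ZMod 2)ˣ) : FieldFour × ZMod 2) = (gen, 1) ^ (i : ℕ) := by
    rw [hi]; rfl
  fin_cases i
  · exact ⟨collapse, ext _ (hi' ▸ by decide)⟩
  · exact ⟨RingHom.id _, ext _ (hi' ▸ by decide)⟩
  · exact ⟨frob.toRingHom.prodMap (RingHom.id _), ext _ (hi' ▸ by decide)⟩

end FieldFour

theorem fullyRealizable_alternatingGroup_three :
    FullyRealizable.{0, v} (alternatingGroup (Fin 3)) := by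
  have h3 : Nat.card (alternatingGroup (Fin 3)) = 3 := by
    rw [nat_card_alternatingGroup]; simp [Nat.factorial]
  have := Fact.mk Nat.prime_three
  exact FieldFour.fullyRealizes.fullyRealizable (mulEquivOfPrimeCardEq FieldFour.card_units h3)

/-! ### The triangular ring realizing the alternating group of degree four -/

/-- The ring of triangular matrices `!![a, b; 0, c]` with `a b : A` and `c : k`. -/
@[ext]
structure TriangularRing (k A : Type*) where
  /-- The upper left entry. -/
  a : A
  /-- The upper right entry. -/
  b : A
  /-- The lower right entry. -/
  c : k
deriving DecidableEq

namespace TriangularRing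

/-- The entries of a triangular matrix. -/
def equivProd (k A : Type*) : TriangularRing k A ≃ A × A × k where
  toFun x := (x.a, x.b, x.c)
  invFun x := ⟨x.1, x.2.1, x.2.2⟩

instance {k A : Type*} [Fintype k] [Fintype A] : Fintype (TriangularRing k A) :=
  Fintype.ofEquiv _ (equivProd k A).symm

section Ring

variable {k A : Type*} [CommRing k] [CommRing A]

instance : Zero (TriangularRing k A) := ⟨⟨0, 0, 0⟩⟩
instance : One (TriangularRing k A) := ⟨⟨1, 0, 1⟩⟩
instance : Add (TriangularRing k A) := ⟨fun x y ↦ ⟨x.a + y.a, x.b + y.b, x.c + y.c⟩⟩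
instance : Neg (TriangularRing k A) := ⟨fun x ↦ ⟨-x.a, -x.b, -x.c⟩⟩

@[simp] theorem zero_a : (0 : TriangularRing k A).a = 0 := rfl
@[simp] theorem zero_b : (0 : TriangularRing k A).b = 0 := rfl
@[simp] theorem zero_c : (0 : TriangularRing k A).c = 0 := rfl
@[simp] theorem one_a : (1 : TriangularRing k A).a = 1 := rfl
@[simp] theorem one_b : (1 : TriangularRing k A).b = 0 := rfl
@[simp] theorem one_c : (1 : TriangularRing k A).c = 1 := rfl
@[simp] theorem add_a (x y : TriangularRing k A) : (x + y).a = x.a + y.a := rfl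
@[simp] theorem add_b (x y : TriangularRing k A) : (x + y).b = x.b + y.b := rfl
@[simp] theorem add_c (x y : TriangularRing k A) : (x + y).c = x.c + y.c := rfl
@[simp] theorem neg_a (x : TriangularRing k A) : (-x).a = -x.a := rfl
@[simp] theorem neg_b (x : TriangularRing k A) : (-x).b = -x.b := rfl
@[simp] theorem neg_c (x : TriangularRing k A) : (-x).c = -x.c := rfl
variable [Algebra k A]

instance : Mul (TriangularRing k A) :=
  ⟨fun x y ↦ ⟨x.a * y.a, x.a * y.b + x.b * algebraMap k A y.c, x.c * y.c⟩⟩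

@[simp] theorem mul_a (x y : TriangularRing k A) : (x * y).a = x.a * y.a := rfl
@[simp] theorem mul_b (x y : TriangularRing k A) :
    (x * y).b = x.a * y.b + x.b * algebraMap k A y.c := rfl
@[simp] theorem mul_c (x y : TriangularRing k A) : (x * y).c = x.c * y.c := rfl

instance : Ring (TriangularRing k A) where
  add_assoc x y z := by ext <;> simp [add_assoc]
  zero_add x := by ext <;> simp
  add_zero x := by ext <;> simp
  add_comm x y := by ext <;> simp [add_comm]
  neg_add_cancel x := by ext <;> simp
  mul_assoc x y z := by ext <;> simp <;> ring
  one_mul x := by ext <;> simp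
  mul_one x := by ext <;> simp
  zero_mul x := by ext <;> simp
  mul_zero x := by ext <;> simp
  left_distrib x y z := by ext <;> simp <;> ring
  right_distrib x y z := by ext <;> simp <;> ring
  nsmul := nsmulRec
  zsmul := zsmulRec

/-- The endomorphism acting by `χ` on the upper left entry, by `d • χ` on the upper right entry, and
conjugated by the unipotent matrix with upper right entry `b`. -/
def twist (χ : A →ₐ[k] A) (d b : A) : TriangularRing k A →+* TriangularRing k A where
  toFun x := ⟨χ x.a, d * χ x.b + b * (χ x.a - algebraMap k A x.c), x.c⟩
  map_zero' := by ext <;> simp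
  map_one' := by ext <;> simp
  map_add' x y := by ext <;> simp; ring
  map_mul' x y := by ext <;> simp; ring

/-- The endomorphism which projects to the lower right entry. -/
def collapse : TriangularRing k A →+* TriangularRing k A where
  toFun x := ⟨algebraMap k A x.c, 0, x.c⟩
  map_zero' := by ext <;> simp
  map_one' := by ext <;> simp
  map_add' x y := by ext <;> simp
  map_mul' x y := by ext <;> simp

end Ring

/-- The triangular ring over the field with four elements and its prime field. -/
abbrev Four : Type := TriangularRing (ZMod 2) FieldFour

open FieldFour

/-- The diagonal unit of order three. -/
def diagUnit : Fourˣ := ⟨⟨gen, 0, 1⟩, ⟨gen ^ 2, 0, 1⟩, by decide, by decide⟩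

/-- The unipotent unit of order two. -/
def unipotentUnit : Fourˣ := ⟨⟨1, 1, 1⟩, ⟨1, 1, 1⟩, by decide, by decide⟩

theorem isUnit_iff (x : Four) : IsUnit x ↔ x.a ≠ 0 ∧ x.c = 1 := by
  constructor
  · rintro ⟨u, rfl⟩
    have ha : ∀ a b : FieldFour, a * b = 1 → a ≠ 0 := by decide
    have hc : ∀ a b : ZMod 2, a * b = 1 → a = 1 := by decide
    exact ⟨ha _ _ (congr_arg TriangularRing.a u.mul_inv),
      hc _ _ (congr_arg TriangularRing.c u.mul_inv)⟩
  · rintro ⟨ha, hc⟩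
    -- In F₄ the inverse of a nonzero a is a², and signs disappear in characteristic 2.
    have key : ∀ x : Four, x.a ≠ 0 → x.c = 1 →
        x * ⟨x.a ^ 2, x.a ^ 2 * x.b, 1⟩ = 1 ∧ ⟨x.a ^ 2, x.a ^ 2 * x.b, 1⟩ * x = 1 := by decide
    exact ⟨⟨x, _, (key x ha hc).1, (key x ha hc).2⟩, rfl⟩

theorem card_units : Nat.card Fourˣ = 12 := by
  have h : Function.Bijective
      fun u : Fourˣ ↦ (⟨u, (isUnit_iff u).1 u.isUnit⟩ : {x : Four // x.a ≠ 0 ∧ x.c = 1}) :=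
    ⟨fun u w huw ↦ Units.ext (congr_arg Subtype.val huw), fun x ↦
      ((isUnit_iff x).2 x.2).imp fun _ hu ↦ Subtype.ext hu⟩
  rw [Nat.card_eq_of_bijective _ h, Nat.card_eq_fintype_card]
  decide

/-- With s diagonal and t unipotent, s^i t s^k has upper row (ω^(i+k), ω^i), which covers every unit
that is not diagonal. -/
theorem exists_eq_diagUnit_pow_mul (u : Fourˣ) : ∃ i j k : Fin 3,
    u = diagUnit ^ (i : ℕ) * unipotentUnit ^ (j : ℕ) * diagUnit ^ (k : ℕ) := by
  have key : ∀ x : Four, x.a ≠ 0 → x.c = 1 → ∃ i j k : Fin 3,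
      x = ⟨gen, 0, 1⟩ ^ (i : ℕ) * ⟨1, 1, 1⟩ ^ (j : ℕ) * ⟨gen, 0, 1⟩ ^ (k : ℕ) := by decide
  obtain ⟨ha, hc⟩ := (isUnit_iff u).1 u.isUnit
  obtain ⟨i, j, k, h⟩ := key u ha hc
  exact ⟨i, j, k, Units.ext h⟩

theorem fullyRealizes : FullyRealizes Four Fourˣ := by
  refine fullyRealizes_units fun f ↦ ?_
  have ext (φ : Four →+* Four) (hs : φ ⟨gen, 0, 1⟩ = f diagUnit)
      (ht : φ ⟨1, 1, 1⟩ = f unipotentUnit) :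
      Units.map (φ : Four →* Four) = f := by
    ext1 u
    obtain ⟨i, j, k, rfl⟩ := exists_eq_diagUnit_pow_mul u
    have hs' : Units.map (φ : Four →* Four) diagUnit = f diagUnit := Units.ext hs
    have ht' : Units.map (φ : Four →* Four) unipotentUnit = f unipotentUnit := Units.ext ht
    simp only [map_mul, map_pow, hs', ht']
  -- The relations s³ = t² = (st)³ = 1 already restrict the images of s and t to pairs that ring
  -- endomorphisms attain.
  have hs : (f diagUnit : Four) ^ 3 = 1 := by
    have : diagUnit ^ 3 = 1 := Units.ext (by decide)
    rw [← Units.val_pow_eq_pow_val, ← map_pow, this, map_one, Units.val_one]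
  have ht : (f unipotentUnit : Four) ^ 2 = 1 := by
    have : unipotentUnit ^ 2 = 1 := Units.ext (by decide)
    rw [← Units.val_pow_eq_pow_val, ← map_pow, this, map_one, Units.val_one]
  have hst : ((f diagUnit : Four) * f unipotentUnit) ^ 3 = 1 := by
    have : (diagUnit * unipotentUnit) ^ 3 = 1 := Units.ext (by decide)
    rw [← Units.val_mul, ← map_mul, ← Units.val_pow_eq_pow_val, ← map_pow, this, map_one,
      Units.val_one]
  generalize (f diagUnit : Four) = x at *
  generalize (f unipotentUnit : Four) = y at *
  have hx : ∀ x : Four, x ^ 3 = 1 → x = 1 ∨ (∃ b, x = twist (AlgHom.id _ _) 0 b ⟨gen, 0, 1⟩) ∨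
      ∃ b, x = twist frob 0 b ⟨gen, 0, 1⟩ := by decide
  have hy : ∀ y : Four, y ^ 2 = 1 → ∃ d, y = ⟨1, d, 1⟩ := by decide
  obtain ⟨d, rfl⟩ := hy y ht
  rcases hx x hs with rfl | ⟨b, rfl⟩ | ⟨b, rfl⟩
  · have hd : ∀ d : FieldFour, ((1 : Four) * ⟨1, d, 1⟩) ^ 3 = 1 → d = 0 := by decide
    obtain rfl := hd d hst
    exact ⟨collapse, ext _ rfl rfl⟩
  · exact ⟨twist (AlgHom.id _ _) d b, ext _ (by ext <;> simp [twist]) (by ext1 <;> simp [twist])⟩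
  · exact ⟨twist frob d b, ext _ (by ext <;> simp [twist]) (by ext1 <;> simp [twist])⟩

/-- The action of the units on the affine line over the field with four elements. -/
def affineAction : Fourˣ →* Equiv.Perm FieldFour :=
  MonoidHom.toHomPerm
    { toFun := fun u x ↦ (u : Four).a * x + (u : Four).b
      map_one' := by funext x; simp; rfl
      map_mul' := fun u w ↦ by
        funext x
        have : (w : Four).c = 1 := ((isUnit_iff w).1 w.isUnit).2
        change _ = (u : Four).a * ((w : Four).a * x + (w : Four).b) + (u : Four).b
        simp [this]
        ring }

theorem affineAction_apply (u : Fourˣ) (x : FieldFour) :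
    affineAction u x = (u : Four).a * x + (u : Four).b := rfl

theorem affineAction_injective : Function.Injective affineAction := by
  intro u w h
  have hb : (u : Four).b = (w : Four).b := by simpa [affineAction_apply] using congr($h 0)
  have ha : (u : Four).a = (w : Four).a := by simpa [affineAction_apply, hb] using congr($h 1)
  have hc : (u : Four).c = (w : Four).c :=
    ((isUnit_iff u).1 u.isUnit).2.trans ((isUnit_iff w).1 w.isUnit).2.symm
  exact Units.ext (TriangularRing.ext ha hb hc)

/-- The 12 affine maps have index two among the 24 permutations of F₄. -/
theorem range_affineAction : affineAction.range = alternatingGroup FieldFour := by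
  apply Equiv.Perm.eq_alternatingGroup_of_index_eq_two
  have hcard : Nat.card affineAction.range = 12 := by
    rw [← card_units]
    exact (Nat.card_congr (MonoidHom.ofInjective affineAction_injective).toEquiv).symm
  have h24 : Nat.card (Equiv.Perm FieldFour) = 24 := by
    rw [Nat.card_perm, Nat.card_eq_fintype_card]; decide
  have := affineAction.range.index_mul_card
  rw [hcard, h24] at this
  omega

end TriangularRing

theorem fullyRealizable_alternatingGroup_four :
    FullyRealizable.{0, v} (alternatingGroup (Fin 4)) :=
  TriangularRing.fullyRealizes.fullyRealizable
    (((MonoidHom.ofInjective TriangularRing.affineAction_injective).trans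
      (MulEquiv.subgroupCongr TriangularRing.range_affineAction)).trans
        (Equiv.altCongrHom (Fintype.equivFinOfCardEq (by decide))))

theorem mainTheorem4 :
    FullyRealizable.{0, v} (alternatingGroup (Fin 2)) ∧
    FullyRealizable.{0, v} (alternatingGroup (Fin 3)) ∧
    ∀ n : ℕ, 4 ≤ n →
      List.TFAE
        [n = 4,
         FullyRealizable.{0, v} (alternatingGroup (Fin n)),
         ¬ IsSimpleGroup (alternatingGroup (Fin n))] := by
  refine ⟨fullyRealizable_alternatingGroup_two, fullyRealizable_alternatingGroup_three,
    fun n hn ↦ ?_⟩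
  tfae_have 1 → 2 := by
    rintro rfl
    exact fullyRealizable_alternatingGroup_four
  tfae_have 2 → 1 := fun h ↦ by
    by_contra hne
    exact not_fullyRealizable_alternatingGroup (by omega) h
  tfae_have 1 → 3 := by
    rintro rfl
    exact not_isSimpleGroup_alternatingGroup_four
  tfae_have 3 → 1 := fun h ↦ by
    by_contra hne
    exact h (alternatingGroup.isSimpleGroup (by simp; omega))
  tfae_finish
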